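/- A generalized braid theory consists of a finite set of crossing types (tags), each tag $a$ having a negative version $\bar a$ (possibly equal to $a$) with $\bar{\bar a}=a$, together with a choice of allowed Reidemeister moves. A braid diagram on $n$ strands consists of $n$ monotone strands in $\mathbb R\times[0,1]$ with finitely many tagged crossings, and is considered up to planar isotopy; that is, it is a word in the elementary braids $a_i$ ($1\le i\le n-1$, $a$ a tag), where $a_i$ is a single crossing with tag $a$ of the strands in positions $i$ and $i+1$, up to $a_ib_j=b_ja_i$ for $|i-j|>1$. The possible moves on braid diagrams are $R_2(a)\colon a_i\bar a_i\leftrightarrow 1$, $R_3(a,b,c)\colon a_ic_{i+1}b_i\leftrightarrow b_{i+1}c_ia_{i+1}$ (where $a,b$ tag the crossings of the middle strand with the two other strands, and $c$ tags the crossing of these two) and the commuting move $a_ib_i\leftrightarrow b_ia_i$. Let $gB_n$ be the set of generalized braids on $n$ strands, i.e. of braid diagrams modulo the moves allowed in the theory, with concatenation as product. The theory is normal if $R_2(a)$ holds for all tags $a$ (so that $gB_n$ is a group, in which $\bar a_i$ is the inverse of $a_i$), and if there is a dominant tag, that is, a tag $x$ such that $R_3(\bar x,x,a)$ and $R_3(x,\bar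 x,a)$ hold for all tags $a$. A braid $\beta\in gB_n$ is called quasitoric if, for some positive integer $q$, it can be written as $\beta=\beta_1\beta_2\cdots\beta_q$ with $\beta_j=y_{j,n-1}y_{j,n-2}\cdots y_{j,1}$, where each $y_{j,i}$ is one of the elementary braids $a_i$, $a$ being any tag (so $\bar a_i$ is also permitted). Theorem. For every normal generalized braid theory and every $n\ge 2$, the set $qgB_n\subseteq gB_n$ of all quasitoric braids on $n$ strands is a subgroup of $gB_n$ under concatenation. -/

import Mathlib

universe u

/-- A generalized braid theory: finitely many crossing types (tags), each tag `a` having a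
negative version `bar a` (possibly equal to `a`), together with the list of the Reidemeister
moves that the theory allows.

The strands of a braid diagram are monotone, so a move creating or removing a kink (`R₁`) never
applies to one, and it is not recorded here. `R4` is the commuting move of two consecutive
crossings of the same two strands, as in the theory of singular braids; a theory without such a
move has `R4 = ∅`. -/
structure BraidTheory where
  Tag : Type u
  finite_tag : Finite Tag
  bar : Tag → Tag
  bar_bar : ∀ a, bar (bar a) = a
  R2 : Set Tag
  R3 : Set (Tag × Tag × Tag)
  R4 : Set (Tag × Tag)

namespace BraidTheory

variable (T : BraidTheory.{u})

/-- Braid diagrams on `n` strands: the finite sequence, read from top to bottom, of the tagged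
crossings. The letter `(i, a)` is a crossing with tag `a` of the strands in the positions `i` and
`i + 1`, where the positions are `0, …, n - 1`. Multiplication is concatenation. -/
abbrev Diagram (n : ℕ) : Type u := FreeMonoid (Fin (n - 1) × T.Tag)

/-- The diagram with a single crossing. -/
def crossing {n : ℕ} (i : Fin (n - 1)) (a : T.Tag) : T.Diagram n := FreeMonoid.of (i, a)

/-- The two sides of the third Reidemeister move `R₃(a, b, c)`. In both of them `a` and `b` are
the crossings of the strand that is in the middle at the top with the two other strands, and `c`
is the crossing of these two. -/
def r3Left {n : ℕ} (i j : Fin (n - 1)) (a b c : T.Tag) : T.Diagram n :=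
  T.crossing i a * T.crossing j c * T.crossing i b

/-- The other side of the third Reidemeister move `R₃(a, b, c)`; see `r3Left`. -/
def r3Right {n : ℕ} (i j : Fin (n - 1)) (a b c : T.Tag) : T.Diagram n :=
  T.crossing j b * T.crossing i c * T.crossing j a

/-- The elementary changes of a diagram: the planar isotopy that exchanges the heights of two
distant crossings, and the Reidemeister moves allowed in the theory. -/
inductive Move {n : ℕ} : T.Diagram n → T.Diagram n → Prop
  | isotopy (i j : Fin (n - 1)) (a b : T.Tag) (h : (i : ℕ) + 1 < j) :
      Move (T.crossing i a * T.crossing j b) (T.crossing j b * T.crossing i a)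
  | r2 (i : Fin (n - 1)) (a : T.Tag) (h : a ∈ T.R2) :
      Move (T.crossing i a * T.crossing i (T.bar a)) 1
  | r3 (i j : Fin (n - 1)) (a b c : T.Tag) (hij : (j : ℕ) = i + 1) (h : (a, b, c) ∈ T.R3) :
      Move (T.r3Left i j a b c) (T.r3Right i j a b c)
  | r4 (i : Fin (n - 1)) (a b : T.Tag) (h : (a, b) ∈ T.R4) :
      Move (T.crossing i a * T.crossing i b) (T.crossing i b * T.crossing i a)

/-- Equivalence of diagrams: related by finitely many elementary changes, in either direction,
each made inside an arbitrary larger diagram. -/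
def diagramCon (n : ℕ) : Con (T.Diagram n) := conGen (T.Move (n := n))

/-- Generalized braids on `n` strands, with concatenation as multiplication. -/
def gB (n : ℕ) : Type u := (T.diagramCon n).Quotient

instance (n : ℕ) : Monoid (T.gB n) := inferInstanceAs (Monoid (T.diagramCon n).Quotient)

/-- The braid represented by a diagram. -/
def toBraid (n : ℕ) : T.Diagram n →* T.gB n := (T.diagramCon n).mk'

/-- The elementary braid `a_i`. -/
def elem {n : ℕ} (i : Fin (n - 1)) (a : T.Tag) : T.gB n := T.toBraid n (T.crossing i a)

/-- The second Reidemeister move for the tag `a` holds in the theory. -/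
def HoldsR2 (a : T.Tag) : Prop :=
  ∀ (n : ℕ) (i : Fin (n - 1)), T.elem i a * T.elem i (T.bar a) = 1

/-- The third Reidemeister move for the tags `a, b, c` holds in the theory. -/
def HoldsR3 (a b c : T.Tag) : Prop :=
  ∀ (n : ℕ) (i j : Fin (n - 1)), (j : ℕ) = i + 1 →
    T.toBraid n (T.r3Left i j a b c) = T.toBraid n (T.r3Right i j a b c)

/-- A theory is regular if the second Reidemeister move holds for all tags. -/
class IsRegular : Prop where
  holdsR2 : ∀ a : T.Tag, T.HoldsR2 a

/-- The tag `x` dominates the theory. -/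
def Dominates (x : T.Tag) : Prop :=
  ∀ a : T.Tag, T.HoldsR3 (T.bar x) x a ∧ T.HoldsR3 x (T.bar x) a

/-- A theory is normal if it is regular and has a dominant tag. -/
class IsNormal : Prop extends T.IsRegular where
  exists_dominant : ∃ x : T.Tag, T.Dominates x

theorem exists_left_inv [T.IsRegular] {n : ℕ} (β : T.gB n) : ∃ γ : T.gB n, γ * β = 1 := by
  obtain ⟨w, rfl⟩ : ∃ w, T.toBraid n w = β := Con.mk'_surjective β
  induction w using FreeMonoid.inductionOn' with
  | one => exact ⟨1, by simp⟩
  | of_mul p w ih =>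
    obtain ⟨γ, hγ⟩ := ih
    have h := IsRegular.holdsR2 (T := T) (T.bar p.2) n p.1
    rw [T.bar_bar] at h
    refine ⟨γ * T.elem p.1 (T.bar p.2), ?_⟩
    have hp : T.toBraid n (FreeMonoid.of p) = T.elem p.1 p.2 := rfl
    rw [map_mul, hp, mul_assoc, ← mul_assoc (T.elem p.1 (T.bar p.2)), h, one_mul, hγ]

/-- In a regular theory the braids on `n` strands form a group under concatenation. -/
noncomputable instance [T.IsRegular] (n : ℕ) : Group (T.gB n) where
  inv β := Classical.choose (T.exists_left_inv β)
  inv_mul_cancel β := Classical.choose_spec (T.exists_left_inv β)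

/-- The braid `y_{n-1} y_{n-2} ⋯ y_1`, where `y_i` is the elementary braid at the `i`-th position
whose tag is prescribed by `y`. -/
def toricRow {n : ℕ} (y : Fin (n - 1) → T.Tag) : T.gB n :=
  (List.ofFn fun i : Fin (n - 1) => T.elem i.rev (y i.rev)).prod

/-- `β` is quasitoric of type `(n, q)`: it is a product `β_1 β_2 ⋯ β_q` of `q` braids of the form
`y_{n-1} y_{n-2} ⋯ y_1`, with arbitrary tags. -/
def IsQuasitoricOfType {n : ℕ} (q : ℕ) (β : T.gB n) : Prop :=
  0 < q ∧ ∃ y : Fin q → Fin (n - 1) → T.Tag, β = (List.ofFn fun j => T.toricRow (y j)).prod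

/-- The set of all quasitoric braids on `n` strands. -/
def qgB (n : ℕ) : Set (T.gB n) := {β | ∃ q : ℕ, T.IsQuasitoricOfType q β}

end BraidTheory

/-! Quasitoric braids are closed under products, so it is enough to invert a single row. Let `D` and
`D'` be the rows with all tags `x` and all tags `bar x`, where `x` is dominant. Then `D ^ n` and `D'
^ n` are opposite full twists (`descProd_pow_mul_inv_pow`), so `D⁻¹` is quasitoric. Write `s i` for
the crossings tagged `x`, and `P`, `Q` for the products `descProd s i`, `descProd s⁻¹ i`. Changing
the tag at position `i` of `D` to `a` multiplies it by `u = P⁻¹ * (s i)⁻¹ * e a i * P`, and every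
row is `D` times such factors. It remains to invert `u`. Up to the quasitoric factors `P⁻¹ * Q` and
`Q⁻¹ * P`, its inverse is `Q⁻¹ * ((e a i)⁻¹ * s i) * Q`. Dominance lets crossings slide along
strands, which shows this to be a conjugate, by powers of `D` and `D'`, of a factor of the same kind
for `bar x` (`conj_mul_mem_of_inv`). -/

section DominantFamily

variable {G ι : Type*} [Group G]

/-! ### Ordered products in a group. -/

/-- The product `y (m - 1) * y (m - 2) * ⋯ * y 0`. -/
def descProd (y : ℕ → G) : ℕ → G
  | 0 => 1
  | m + 1 => y m * descProd y m

/-- The product `y k * y (k + 1) * ⋯ * y (k + l - 1)`. -/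
def ascProd (y : ℕ → G) (k : ℕ) : ℕ → G
  | 0 => 1
  | l + 1 => ascProd y k l * y (k + l)

/-- The relations between the elementary braids `e a i`, `i < N`, of a normal theory,
where `s` is the family of the elementary braids with the dominant tag. -/
structure DominantFamily (N : ℕ) (e : ι → ℕ → G) (s : ℕ → G) : Prop where
  far : ∀ a b i j, i + 1 < j → Commute (e a i) (e b j)
  slide : ∀ a i, i + 1 < N → s (i + 1) * s i * e a (i + 1) = e a i * (s (i + 1) * s i)
  slide_inv : ∀ a i, i + 1 < N →
    (s (i + 1))⁻¹ * (s i)⁻¹ * e a (i + 1) = e a i * ((s (i + 1))⁻¹ * (s i)⁻¹)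
  exists_inv : ∀ a, ∃ b, e b = (e a)⁻¹
  exists_eq : ∃ x, e x = s

theorem descProd_congr {y z : ℕ → G} {m : ℕ} (h : ∀ i < m, y i = z i) :
    descProd y m = descProd z m := by
  induction m with
  | zero => rfl
  | succ m ih =>
    rw [descProd, descProd, h m (Nat.lt_succ_self m), ih fun i hi => h i (by omega)]

theorem descProd_eq_prod_ofFn (y : ℕ → G) (m : ℕ) :
    descProd y m = (List.ofFn fun i : Fin m => y (i.rev : ℕ)).prod := by
  induction m with
  | zero => simp [descProd]
  | succ m ih =>
    rw [descProd, ih, List.ofFn_succ, List.prod_cons]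
    simp [Fin.rev_succ]

theorem descProd_inv (y : ℕ → G) (m : ℕ) : (descProd y⁻¹ m)⁻¹ = ascProd y 0 m := by
  induction m with
  | zero => simp [descProd, ascProd]
  | succ m ih => simp [descProd, ascProd, ih]

theorem commute_descProd {y : ℕ → G} {g : G} {m : ℕ} (h : ∀ i < m, Commute g (y i)) :
    Commute g (descProd y m) := by
  induction m with
  | zero => exact Commute.one_right g
  | succ m ih =>
    exact (h m (Nat.lt_succ_self m)).mul_right (ih fun i hi => h i (by omega))

theorem commute_ascProd {y : ℕ → G} {g : G} {k l : ℕ} (h : ∀ i < k + l, Commute g (y i)) :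
    Commute g (ascProd y k l) := by
  induction l with
  | zero => exact Commute.one_right g
  | succ l ih => exact (ih fun i hi => h i (by omega)).mul_right (h _ (by omega))

/-- Changing one factor of a descending product. -/
theorem descProd_update (s : ℕ → G) {i m : ℕ} (hi : i < m) (b : G) :
    descProd (Function.update s i b) m =
      descProd s m * ((descProd s i)⁻¹ * (s i)⁻¹ * b * descProd s i) := by
  induction m with
  | zero => omega
  | succ m ih =>
    rcases Nat.lt_succ_iff_lt_or_eq.mp hi with h | rfl
    · rw [descProd, descProd, ih h, Function.update_of_ne h.ne', ← mul_assoc]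
    · rw [descProd, descProd, Function.update_self,
        descProd_congr fun j hj => Function.update_of_ne hj.ne b s]
      group

/-- The quotient telescopes into the factors produced by changing single entries. -/
theorem descProd_eq_mul_mem {U : Subgroup G} (s y : ℕ → G) {m : ℕ}
    (h : ∀ i < m, (descProd s i)⁻¹ * (s i)⁻¹ * y i * descProd s i ∈ U) :
    (descProd s m)⁻¹ * descProd y m ∈ U := by
  induction m with
  | zero => simp [descProd]
  | succ m ih =>
    have := U.mul_mem (h m (Nat.lt_succ_self m)) (ih fun i hi => h i (by omega))
    convert this using 1
    simp only [descProd]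
    group

/-! ### Shifts, the full twist and sliding crossings. -/

namespace DominantFamily

variable {N : ℕ} {e : ι → ℕ → G} {s : ℕ → G}

/-- By this symmetry every later result is also available for `s⁻¹`. -/
theorem inv (H : DominantFamily N e s) : DominantFamily N e s⁻¹ where
  far := H.far
  slide := H.slide_inv
  slide_inv := by simpa using H.slide
  exists_inv := H.exists_inv
  exists_eq := by
    obtain ⟨x, hx⟩ := H.exists_eq
    obtain ⟨z, hz⟩ := H.exists_inv x
    exact ⟨z, by rw [hz, hx]⟩

theorem far_left (H : DominantFamily N e s) (a : ι) {i j : ℕ} (h : i + 1 < j) :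
    Commute (s i) (e a j) := by
  obtain ⟨x, rfl⟩ := H.exists_eq
  exact H.far _ _ _ _ h

theorem far_right (H : DominantFamily N e s) (a : ι) {i j : ℕ} (h : i + 1 < j) :
    Commute (e a i) (s j) := by
  obtain ⟨x, rfl⟩ := H.exists_eq
  exact H.far _ _ _ _ h

/-- Conjugation with the descending product shifts the positions. -/
theorem descProd_mul (H : DominantFamily N e s) (a : ι) {i m : ℕ} (hi : i + 1 < m)
    (hm : m ≤ N) : descProd s m * e a (i + 1) = e a i * descProd s m := by
  induction m with
  | zero => omega
  | succ m ih =>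
    rcases Nat.lt_succ_iff_lt_or_eq.mp hi with h | rfl
    · rw [descProd, mul_assoc, ih h (by omega), ← mul_assoc, ← mul_assoc,
        (H.far_right a h).eq]
    · have hc : Commute (e a (i + 1)) (descProd s i) :=
        commute_descProd fun j hj => (H.far_left a (by omega)).symm
      rw [descProd, descProd, mul_assoc, mul_assoc, ← hc.eq, ← mul_assoc, ← mul_assoc,
        H.slide a i (by omega)]
      simp only [mul_assoc]

theorem descProd_mul_self (H : DominantFamily N e s) {i m : ℕ} (hi : i + 1 < m)
    (hm : m ≤ N) : descProd s m * s (i + 1) = s i * descProd s m := by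
  obtain ⟨x, hx⟩ := H.exists_eq
  simpa [hx] using H.descProd_mul x hi hm

theorem descProd_pow_mul (H : DominantFamily N e s) (a : ι) {i k m : ℕ} (hi : k + i < m)
    (hm : m ≤ N) : descProd s m ^ k * e a (k + i) = e a i * descProd s m ^ k := by
  induction k with
  | zero => simp
  | succ k ih =>
    rw [pow_succ, mul_assoc, show k + 1 + i = k + i + 1 by omega,
      H.descProd_mul a (by omega) hm, ← mul_assoc, ih (by omega), mul_assoc]

theorem descProd_pow_mul_self (H : DominantFamily N e s) {i k m : ℕ} (hi : k + i < m)
    (hm : m ≤ N) : descProd s m ^ k * s (k + i) = s i * descProd s m ^ k := by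
  obtain ⟨x, hx⟩ := H.exists_eq
  simpa [hx] using H.descProd_pow_mul x hi hm

theorem descProd_pow_mul_ascProd (H : DominantFamily N e s) {k l m : ℕ} (hl : k + l ≤ m)
    (hm : m ≤ N) :
    descProd s m ^ k * ascProd s k l = ascProd s 0 l * descProd s m ^ k := by
  induction l with
  | zero => simp [ascProd]
  | succ l ih =>
    rw [ascProd, ← mul_assoc, ih (by omega), mul_assoc,
      H.descProd_pow_mul_self (by omega) hm, ascProd, zero_add, mul_assoc]

/-- The full twist is one strand encircling all the others, times the full twist of those others. -/
theorem descProd_succ_pow (H : DominantFamily N e s) {m : ℕ} (hm : m + 1 ≤ N) :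
    descProd s (m + 1) ^ (m + 2) =
      descProd s (m + 1) * ascProd s 0 (m + 1) * descProd s m ^ (m + 1) := by
  have key : ∀ l ≤ m + 1, descProd s (m + 1) ^ (m + 1) =
      ascProd s 0 l * descProd s (m + 1) ^ (m + 1 - l) * descProd s m ^ l := by
    intro l hl
    induction l with
    | zero => simp [ascProd]
    | succ l ih =>
      obtain ⟨k, hk⟩ : ∃ k, k + l = m := ⟨m - l, by omega⟩
      have h := H.descProd_pow_mul_self (i := l) (k := k) (m := m + 1) (by omega) hm
      rw [ih (by omega), show m + 1 - l = k + 1 by omega,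
        show m + 1 - (l + 1) = k by omega, pow_succ, pow_succ', ascProd, zero_add]
      -- Split `s m` off one factor; the `k` factors to its left shift it to `s l`.
      nth_rewrite 2 [descProd]
      rw [hk] at h
      rw [← mul_assoc (descProd s (m + 1) ^ k), h]
      simp only [mul_assoc]
  rw [pow_succ', key (m + 1) le_rfl]
  simp [mul_assoc]

theorem descProd_pow_mul_inv_pow (H : DominantFamily N e s) {m : ℕ} (hm : m ≤ N) :
    descProd s m ^ (m + 1) * descProd s⁻¹ m ^ (m + 1) = 1 := by
  induction m with
  | zero => simp [descProd]
  | succ m ih =>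
    have hE : ascProd s 0 (m + 1) = (descProd s⁻¹ (m + 1))⁻¹ := (descProd_inv s _).symm
    have hE' : ascProd s⁻¹ 0 (m + 1) = (descProd s (m + 1))⁻¹ := by
      rw [← descProd_inv, inv_inv]
    -- The ascending product raises each position by one and the descending product lowers it again.
    have hc : Commute (descProd s (m + 1) * ascProd s 0 (m + 1)) (descProd s m) := by
      refine commute_descProd fun i hi => ?_
      have h₁ := H.descProd_mul_self (i := i) (m := m + 1) (by omega) hm
      have h₂ := H.inv.descProd_mul_self (i := i) (m := m + 1) (by omega) hm
      have h₃ : ascProd s 0 (m + 1) * s i = s (i + 1) * ascProd s 0 (m + 1) := by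
        rw [hE, inv_mul_eq_iff_eq_mul, ← mul_assoc, eq_mul_inv_iff_mul_eq]
        have h₄ := congrArg (fun g => s i * g * s (i + 1)) h₂
        simpa [mul_assoc] using h₄
      change _ * _ = _ * _
      rw [mul_assoc, h₃, ← mul_assoc, h₁, mul_assoc]
    have hp := hc.pow_right (m + 1)
    rw [H.descProd_succ_pow hm, H.inv.descProd_succ_pow hm, hp.eq, hE, hE']
    simpa [mul_assoc] using ih (by omega)

/-- Sliding a crossing along the remaining strands, on either side. -/
theorem conj_descProd_eq_conj_ascProd (H : DominantFamily N e s) (a : ι) {k l : ℕ}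
    (h : k + l < N) :
    (descProd s⁻¹ (k + l + 1) * (descProd s⁻¹ (k + 1))⁻¹) * (e a k * s k) *
        (descProd s⁻¹ (k + l + 1) * (descProd s⁻¹ (k + 1))⁻¹)⁻¹ =
      ascProd s k l * (e a (k + l) * s (k + l)) * (ascProd s k l)⁻¹ := by
  induction l with
  | zero => simp [ascProd]
  | succ l ih =>
    have ih := ih (by omega)
    have hstep : descProd s⁻¹ (k + (l + 1) + 1) =
        (s (k + l + 1))⁻¹ * descProd s⁻¹ (k + l + 1) := rfl
    have hc : Commute (s (k + l + 1)) (ascProd s k l) :=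
      commute_ascProd fun i hi => by
        obtain ⟨x, hx⟩ := H.exists_eq
        simpa [hx] using (H.far_left x (i := i) (j := k + l + 1) (by omega)).symm
    have h₁ := H.slide a (k + l) (by omega)
    -- The braid relation: the slide for the dominant tag itself.
    have h₂ : s (k + l + 1) * s (k + l) * s (k + l + 1) =
        s (k + l) * (s (k + l + 1) * s (k + l)) := by
      obtain ⟨x, hx⟩ := H.exists_eq
      simpa [hx] using H.slide x (k + l) (by omega)
    have h₃ : (s (k + l + 1))⁻¹ * (e a (k + l) * s (k + l)) * s (k + l + 1) =
        s (k + l) * (e a (k + l + 1) * s (k + l + 1)) * (s (k + l))⁻¹ := by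
      rw [eq_mul_inv_iff_mul_eq, mul_assoc, mul_assoc, inv_mul_eq_iff_eq_mul]
      calc _ = e a (k + l) * (s (k + l) * (s (k + l + 1) * s (k + l))) := by
            simp only [mul_assoc]
        _ = e a (k + l) * (s (k + l + 1) * s (k + l)) * s (k + l + 1) := by
            rw [← h₂]; simp only [mul_assoc]
        _ = _ := by rw [← h₁]; simp only [mul_assoc]
    calc _ = (s (k + l + 1))⁻¹ *
          ((descProd s⁻¹ (k + l + 1) * (descProd s⁻¹ (k + 1))⁻¹) * (e a k * s k) *
            (descProd s⁻¹ (k + l + 1) * (descProd s⁻¹ (k + 1))⁻¹)⁻¹) * s (k + l + 1) := by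
          rw [hstep]; group
      _ = (s (k + l + 1))⁻¹ * ascProd s k l * (e a (k + l) * s (k + l)) *
            ((ascProd s k l)⁻¹ * s (k + l + 1)) := by
          rw [ih]; simp only [mul_assoc]
      _ = ascProd s k l * ((s (k + l + 1))⁻¹ * (e a (k + l) * s (k + l)) * s (k + l + 1)) *
            (ascProd s k l)⁻¹ := by
          rw [hc.inv_left.eq, ← hc.inv_right.eq]; simp only [mul_assoc]
      _ = _ := by rw [h₃, ascProd, ← add_assoc]; group

/-! ### Inverses in the monoid generated by the rows. -/

/-- The monoid of quasitoric braids. -/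
def rowMonoid (N : ℕ) (e : ι → ℕ → G) : Submonoid G :=
  Submonoid.closure (Set.range fun t : ℕ → ι => descProd (fun i => e (t i) i) N)

theorem row_mem (e : ι → ℕ → G) (t : ℕ → ι) :
    descProd (fun i => e (t i) i) N ∈ rowMonoid N e :=
  Submonoid.subset_closure ⟨t, rfl⟩

theorem descProd_mem (H : DominantFamily N e s) : descProd s N ∈ rowMonoid N e := by
  obtain ⟨x, rfl⟩ := H.exists_eq
  exact row_mem e fun _ => x

theorem descProd_inv_mem (H : DominantFamily N e s) : (descProd s N)⁻¹ ∈ rowMonoid N e := by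
  have h : (descProd s N)⁻¹ = descProd s N ^ N * descProd s⁻¹ N ^ (N + 1) := by
    rw [inv_eq_iff_mul_eq_one, ← mul_assoc, ← pow_succ']
    exact H.descProd_pow_mul_inv_pow le_rfl
  rw [h]
  exact mul_mem (pow_mem H.descProd_mem _) (pow_mem H.inv.descProd_mem _)

/-- This is the dominant row's inverse times the row with one tag changed. -/
theorem conj_inv_mul_mem (H : DominantFamily N e s) (a : ι) {i : ℕ} (hi : i < N) :
    (descProd s i)⁻¹ * (s i)⁻¹ * e a i * descProd s i ∈ rowMonoid N e := by
  classical
  have h : descProd (Function.update s i (e a i)) N ∈ rowMonoid N e := by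
    obtain ⟨x, rfl⟩ := H.exists_eq
    convert row_mem e (Function.update (fun _ => x) i a) using 2
    ext j
    by_cases hj : j = i
    · subst hj; simp
    · simp [hj]
  rw [descProd_update s hi] at h
  simpa using mul_mem H.descProd_inv_mem h

theorem inv_mul_descProd_inv_mem (H : DominantFamily N e s) {i : ℕ} (hi : i ≤ N) :
    (descProd s i)⁻¹ * descProd s⁻¹ i ∈ rowMonoid N e := by
  induction i with
  | zero => simp [descProd]
  | succ i ih =>
    obtain ⟨z, hz⟩ := H.inv.exists_eq
    have h := mul_mem (H.conj_inv_mul_mem z (i := i) (by omega)) (ih (by omega))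
    convert h using 1
    simp only [descProd, hz, Pi.inv_apply]
    group

theorem conj_mul_mem_of_inv (H : DominantFamily N e s) (a : ι) {j : ℕ} (hj : j < N) :
    (descProd s⁻¹ j)⁻¹ * (e a j * s j) * descProd s⁻¹ j ∈ rowMonoid N e := by
  -- With this `k`, the crossing slides from position `k` to the last position `k + j`; conjugation
  -- by the `k`-th power of the row then lowers it to `j`.
  obtain ⟨k, hk⟩ : ∃ k, k + j + 1 = N := ⟨N - 1 - j, by omega⟩
  have h₁ := mul_mem (mul_mem H.inv.descProd_mem
    (H.inv.conj_inv_mul_mem a (i := k) (by omega))) H.inv.descProd_inv_mem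
  have h₂ := H.conj_descProd_eq_conj_ascProd a (k := k) (l := j) (by omega)
  have h₃ : ascProd s k j * (e a (k + j) * s (k + j)) * (ascProd s k j)⁻¹ ∈
      rowMonoid N e := by
    rw [← h₂, hk]
    convert h₁ using 1
    simp only [descProd, Pi.inv_apply]
    group
  have h₄ := mul_mem (mul_mem (pow_mem H.descProd_mem k) h₃)
    (pow_mem H.descProd_inv_mem k)
  convert h₄ using 1
  rw [descProd_inv, inv_pow, eq_mul_inv_iff_mul_eq, ← inv_inv (descProd s⁻¹ j), descProd_inv]
  have h₅ := H.descProd_pow_mul_ascProd (k := k) (l := j) (m := N) (by omega) le_rfl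
  have h₆ := H.descProd_pow_mul a (i := j) (k := k) (m := N) (by omega) le_rfl
  have h₇ := H.descProd_pow_mul_self (i := j) (k := k) (m := N) (by omega) le_rfl
  have h₈ : (ascProd s 0 j)⁻¹ * descProd s N ^ k = descProd s N ^ k * (ascProd s k j)⁻¹ := by
    rw [inv_mul_eq_iff_eq_mul, ← mul_assoc, ← h₅, mul_inv_cancel_right]
  calc _ = ascProd s 0 j * (e a j * (s j * descProd s N ^ k)) * (ascProd s k j)⁻¹ := by
        rw [mul_assoc, h₈]; simp only [mul_assoc]
    _ = ascProd s 0 j * descProd s N ^ k * (e a (k + j) * s (k + j)) * (ascProd s k j)⁻¹ := by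
        rw [← h₇, ← mul_assoc (e a j), ← h₆]; simp only [mul_assoc]
    _ = _ := by rw [← h₅]; simp only [mul_assoc]

theorem conj_inv_mul_inv_mem (H : DominantFamily N e s) (a : ι) {i : ℕ} (hi : i < N) :
    ((descProd s i)⁻¹ * (s i)⁻¹ * e a i * descProd s i)⁻¹ ∈ rowMonoid N e := by
  obtain ⟨b, hb⟩ := H.exists_inv a
  have h := mul_mem (mul_mem (H.inv_mul_descProd_inv_mem hi.le) (H.conj_mul_mem_of_inv b hi))
    (H.inv.inv_mul_descProd_inv_mem hi.le)
  convert h using 1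
  simp only [hb, Pi.inv_apply, inv_inv]
  group

theorem row_inv_mem (H : DominantFamily N e s) (t : ℕ → ι) :
    (descProd (fun i => e (t i) i) N)⁻¹ ∈ rowMonoid N e := by
  -- The units of the monoid.
  let U : Subgroup G :=
    { carrier := {g | g ∈ rowMonoid N e ∧ g⁻¹ ∈ rowMonoid N e}
      one_mem' := by simp [one_mem]
      mul_mem' := fun {g h} hg hh =>
        ⟨mul_mem hg.1 hh.1, by rw [mul_inv_rev]; exact mul_mem hh.2 hg.2⟩
      inv_mem' := fun {g} hg => ⟨hg.2, by rw [inv_inv]; exact hg.1⟩ }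
  have h₁ : descProd s N ∈ U := ⟨H.descProd_mem, H.descProd_inv_mem⟩
  have h₂ : (descProd s N)⁻¹ * descProd (fun i => e (t i) i) N ∈ U :=
    descProd_eq_mul_mem s _ fun i hi =>
      ⟨H.conj_inv_mul_mem (t i) hi, H.conj_inv_mul_inv_mem (t i) hi⟩
  have h₃ := U.mul_mem h₁ h₂
  rw [mul_inv_cancel_left] at h₃
  exact h₃.2

theorem inv_mem_rowMonoid (H : DominantFamily N e s) {g : G} (hg : g ∈ rowMonoid N e) :
    g⁻¹ ∈ rowMonoid N e := by
  induction hg using Submonoid.closure_induction with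
  | mem g hg => obtain ⟨t, rfl⟩ := hg; exact H.row_inv_mem t
  | one => simp [one_mem]
  | mul g h _ _ hg hh => rw [mul_inv_rev]; exact mul_mem hh hg

end DominantFamily

end DominantFamily

/-! ### Transfer to generalized braids. -/

namespace BraidTheory

/-- The elementary braids on `n` strands, with the positions extended to all natural numbers. -/
noncomputable def natElem (T : BraidTheory.{u}) (n : ℕ) (a : T.Tag) (i : ℕ) : T.gB n :=
  if h : i < n - 1 then T.elem ⟨i, h⟩ a else 1

variable (T : BraidTheory.{u})

theorem elem_commute {n : ℕ} {i j : Fin (n - 1)} (a b : T.Tag) (h : (i : ℕ) + 1 < j) :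
    T.elem i a * T.elem j b = T.elem j b * T.elem i a := by
  have := (Con.eq (T.diagramCon n)).mpr (ConGen.Rel.of _ _ (Move.isotopy i j a b h))
  exact this

theorem natElem_bar [T.IsRegular] (n : ℕ) (a : T.Tag) :
    T.natElem n (T.bar a) = (T.natElem n a)⁻¹ := by
  funext i
  rw [Pi.inv_apply, natElem, natElem]
  split_ifs with h
  · exact (inv_eq_of_mul_eq_one_right (IsRegular.holdsR2 a n ⟨i, h⟩)).symm
  · simp

theorem HoldsR3.natElem_eq {T : BraidTheory.{u}} {a b c : T.Tag} (h : T.HoldsR3 a b c) {n i : ℕ}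
    (hi : i + 1 < n - 1) :
    T.natElem n a i * T.natElem n c (i + 1) * T.natElem n b i =
      T.natElem n b (i + 1) * T.natElem n c i * T.natElem n a (i + 1) := by
  have := h n ⟨i, by omega⟩ ⟨i + 1, hi⟩ rfl
  simp only [natElem, hi, show i < n - 1 by omega, dif_pos]
  simpa only [r3Left, r3Right, map_mul, elem] using this

theorem Dominates.dominantFamily {T : BraidTheory.{u}} [T.IsRegular] {x : T.Tag}
    (hx : T.Dominates x) (n : ℕ) :
    DominantFamily (n - 1) (T.natElem n) (T.natElem n x) where
  far a b i j h := by
    change _ * _ = _ * _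
    by_cases hj : j < n - 1
    · simp only [natElem, hj, show i < n - 1 by omega, dif_pos]
      exact T.elem_commute a b h
    -- Beyond the last position `natElem` is `1`, which commutes with everything.
    · simp [natElem, hj]
  slide a i hi := by
    have h := (hx a).2.natElem_eq hi
    rw [natElem_bar, Pi.inv_apply, Pi.inv_apply, mul_inv_eq_iff_eq_mul, mul_assoc, mul_assoc,
      eq_inv_mul_iff_mul_eq] at h
    rw [mul_assoc, h]
  slide_inv a i hi := by
    have h := (hx a).1.natElem_eq hi
    rw [natElem_bar, Pi.inv_apply, Pi.inv_apply, eq_mul_inv_iff_mul_eq] at h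
    rw [mul_assoc, inv_mul_eq_iff_eq_mul, ← mul_assoc, ← mul_assoc, ← h]
    group
  exists_inv a := ⟨T.bar a, T.natElem_bar n a⟩
  exists_eq := ⟨x, rfl⟩

theorem toricRow_eq [T.IsRegular] {n : ℕ} (t : ℕ → T.Tag) :
    T.toricRow (fun i : Fin (n - 1) => t i) =
      descProd (fun i => T.natElem n (t i) i) (n - 1) := by
  rw [descProd_eq_prod_ofFn, toricRow]
  congr 2
  funext i
  rw [natElem, dif_pos i.rev.isLt]

theorem toricRow_mem_qgB {n : ℕ} (y : Fin (n - 1) → T.Tag) : T.toricRow y ∈ T.qgB n :=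
  ⟨1, one_pos, fun _ => y, by simp⟩

theorem mul_mem_qgB {n : ℕ} {β γ : T.gB n} (hβ : β ∈ T.qgB n) (hγ : γ ∈ T.qgB n) :
    β * γ ∈ T.qgB n := by
  obtain ⟨p, hp, y, rfl⟩ := hβ
  obtain ⟨q, hq, z, rfl⟩ := hγ
  refine ⟨p + q, by omega, Fin.append y z, ?_⟩
  rw [← List.prod_append, ← List.ofFn_fin_append]
  congr 2
  funext j
  induction j using Fin.addCases <;> simp

theorem pow_succ_mem_qgB {n : ℕ} {β : T.gB n} (hβ : β ∈ T.qgB n) (k : ℕ) :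
    β ^ (k + 1) ∈ T.qgB n := by
  induction k with
  | zero => simpa using hβ
  | succ k ih => rw [pow_succ]; exact T.mul_mem_qgB ih hβ

theorem coe_rowMonoid_eq_qgB [T.IsRegular] {x : T.Tag} (hx : T.Dominates x) (n : ℕ) :
    (DominantFamily.rowMonoid (n - 1) (T.natElem n) : Set (T.gB n)) = T.qgB n := by
  have H := hx.dominantFamily n
  have hrow (t : ℕ → T.Tag) :
      descProd (fun i => T.natElem n (t i) i) (n - 1) ∈ T.qgB n := by
    rw [← T.toricRow_eq]; exact T.toricRow_mem_qgB _
  ext β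
  constructor
  · intro hβ
    induction hβ using Submonoid.closure_induction with
    | mem g hg => obtain ⟨t, rfl⟩ := hg; exact hrow t
    | one =>
      -- The empty product is not allowed as a quasitoric form, so `1` is written as two cancelling
      -- full twists.
      rw [← H.descProd_pow_mul_inv_pow le_rfl, ← natElem_bar]
      exact T.mul_mem_qgB (T.pow_succ_mem_qgB (hrow fun _ => x) _)
        (T.pow_succ_mem_qgB (hrow fun _ => T.bar x) _)
    | mul g h _ _ hg hh => exact T.mul_mem_qgB hg hh
  · rintro ⟨q, -, y, rfl⟩
    refine list_prod_mem fun g hg => ?_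
    obtain ⟨j, rfl⟩ := List.mem_ofFn.mp hg
    have h := T.toricRow_eq (n := n) fun i => if h : i < n - 1 then y j ⟨i, h⟩ else x
    simp only [Fin.is_lt, dif_pos, Fin.eta] at h
    rw [show T.toricRow (y j) = _ from h]
    exact DominantFamily.row_mem _ _

end BraidTheory

theorem mainTheorem2 (T : BraidTheory.{u}) [T.IsNormal] (n : ℕ) (hn : 2 ≤ n) :
    ∃ H : Subgroup (T.gB n), (H : Set (T.gB n)) = T.qgB n := by
  obtain ⟨x, hx⟩ := BraidTheory.IsNormal.exists_dominant (T := T)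
  exact ⟨{ DominantFamily.rowMonoid (n - 1) (T.natElem n) with
    inv_mem' := (hx.dominantFamily n).inv_mem_rowMonoid }, T.coe_rowMonoid_eq_qgB hx n⟩
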